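/- Let $\Sigma$ be a finite alphabet and let $L \subseteq \Sigma^*$ be a regular language. Then the dynamic membership problem of $L$ is in the class $\mathrm{UDynProp}$ if and only if the syntactic monoid of $L$ (the transition monoid of its minimal deterministic automaton) is a group. Here the dynamic membership problem of $L$ is the following. For $n \in \mathbb{N}$, the input is a word $w = w_1 \cdots w_n$ with $w_i \in \Sigma \cup \{\epsilon\}$, encoded as the relational structure with domain $\{1,\dots,n\}$, the linear order $\le$, and for every $\sigma \in \Sigma$ the unary relation $W_\sigma = \{ i \mid w_i = \sigma \}$. Initially $w = w^0 := \epsilon^n$. A change $\mathrm{set}_\sigma(i)$, with $\sigma \in \Sigma \cup \{\epsilon\}$ and $1 \le i \le n$, replaces $w_i$ by $\sigma$. A dynamic program consists of a finite schema of auxiliary relation symbols with a distinguished $0$-ary symbol $q$; for every auxiliary symbol $R$ a first-order formula over $\{\le\} \cup \{W_\sigma \mid \sigma \in \Sigma\}$ (with equality) that defines the initial value of $R$ in the structure $w^0$; and, for every $R$ and every $\sigma \in \Sigma\cup\{\epsilon\}$, an update formula $\varphi^R_\sigma(\bar x; y)$ over the input and auxiliary relations. When a change $\mathrm{set}_\sigma(i)$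 turns the word $w$ into $w'$, every auxiliary relation $R$ is simultaneously replaced by the set of all tuples $\bar a$ such that $\varphi^R_\sigma(\bar a; i)$ holds in the structure formed by the new word $w'$ and the old auxiliary relations. The program maintains the problem if, for every $n$ and after every finite sequence of changes, $q$ is true if and only if the current word $w_1 \cdots w_n$ is in $L$. The problem is in $\mathrm{UDynProp}$ if some dynamic program maintains it whose auxiliary relations are all at most unary (of arity $0$ or $1$) and whose update formulas are all quantifier-free. -/

import Mathlib

/-! Dynamic programs for the membership problem of a word language, the class of languages
maintainable with quantifier-free updates and at most unary auxiliary relations, and the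
syntactic monoid of a language. -/

namespace DynWord

universe u

/-! ### Words with empty positions -/

/-- A word over the positions `Fin n`; each position carries a letter, or `none` standing for `ε`. -/
abbrev PosWord (α : Type u) (n : ℕ) : Type u := Fin n → Option α

/-- The string spelled by the positions, from left to right, where `ε`-positions contribute nothing. -/
def PosWord.toList {α : Type u} {n : ℕ} (w : PosWord α n) : List α :=
  (List.ofFn w).reduceOption

/-! ### Vocabularies and structures -/

/-- The relation symbols of the input: a unary `W_a` for each letter `a`, and the binary `≤`. -/
inductive InputRel (α : Type u) : ℕ → Type u
  | letter (a : α) : InputRel α 1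
  | le : InputRel α 2

/-- The vocabulary of input words (relational; equality is built into the logic). -/
def inputLang (α : Type u) : FirstOrder.Language.{0, u} where
  Functions := fun _ => Empty
  Relations := InputRel α

/-- A finite auxiliary relational schema. -/
structure AuxSchema where
  /-- the auxiliary relation symbols -/
  Sym : Type
  /-- there are finitely many of them -/
  finite_sym : Finite Sym
  /-- the arity of each symbol; arity `0` means an auxiliary bit -/
  arity : Sym → ℕ

/-- The auxiliary relation symbols, indexed by their arities. -/
inductive AuxRel (S : AuxSchema) : ℕ → Type
  | sym (R : S.Sym) : AuxRel S (S.arity R)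

/-- The vocabulary of a schema (relational). -/
def AuxSchema.lang (S : AuxSchema) : FirstOrder.Language.{0, 0} where
  Functions := fun _ => Empty
  Relations := AuxRel S

/-- The vocabulary of update formulas: input relations together with auxiliary relations. -/
abbrev programLang (α : Type u) (S : AuxSchema) : FirstOrder.Language.{0, u} :=
  (inputLang α).sum S.lang

/-- Auxiliary relations over the domain `Fin n`. -/
abbrev AuxData (S : AuxSchema) (n : ℕ) : Type :=
  ∀ R : S.Sym, (Fin (S.arity R) → Fin n) → Prop

/-- The relational structure encoding a word. -/
@[reducible]
def inputStructure {α : Type u} {n : ℕ} (w : PosWord α n) : (inputLang α).Structure (Fin n) where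
  funMap := fun f _ => f.elim
  RelMap := fun r v =>
    match r, v with
    | .letter a, v => w (v 0) = some a
    | .le, v => v 0 ≤ v 1

/-- The relational structure given by auxiliary relations. -/
@[reducible]
def auxStructure {S : AuxSchema} {n : ℕ} (A : AuxData S n) : S.lang.Structure (Fin n) where
  funMap := fun f _ => f.elim
  RelMap := fun r v =>
    match r, v with
    | .sym R, v => A R v

/-- The structure `(w, A)` in which update formulas are evaluated. -/
@[reducible]
def programStructure {α : Type u} {S : AuxSchema} {n : ℕ} (w : PosWord α n) (A : AuxData S n) :
    (programLang α S).Structure (Fin n) :=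
  @FirstOrder.Language.sumStructure (inputLang α) S.lang (Fin n) (inputStructure w) (auxStructure A)

/-! ### Dynamic programs -/

/-- A dynamic program for words over the alphabet `α`. Changes are of the form `set_σ(y)` with
`σ : Option α`, where `none` stands for `ε`. -/
structure Program (α : Type u) where
  /-- the auxiliary schema -/
  schema : AuxSchema
  /-- for each auxiliary relation `R`, a first-order formula over the input vocabulary that
  defines the initial value of `R` -/
  init : ∀ R : schema.Sym, (inputLang α).Formula (Fin (schema.arity R))
  /-- for each `σ` and each auxiliary relation `R`, the update formula `φ(x₁, …, x_k ; y)`;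
  the variable `Sum.inr ()` is `y`, the changed position -/
  update : Option α → ∀ R : schema.Sym,
    (programLang α schema).Formula (Fin (schema.arity R) ⊕ Unit)
  /-- the distinguished answer bit -/
  answer : schema.Sym
  /-- the answer bit is a `0`-ary auxiliary relation -/
  answer_arity : schema.arity answer = 0

namespace Program

variable {α : Type u}

/-- The initial word: all `n` positions are empty. -/
def initWord (α : Type u) (n : ℕ) : PosWord α n := fun _ => none

/-- The initial auxiliary relations, defined by the initialization formulas on the initial word. -/
def initAux (P : Program α) (n : ℕ) : AuxData P.schema n := fun R a =>
  letI := inputStructure (initWord α n)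
  (P.init R).Realize a

/-- One change `set_σ(i)`: first the word is changed, then all auxiliary relations are redefined
simultaneously, evaluating the update formulas on the new word and the old auxiliary relations. -/
def step (P : Program α) {n : ℕ} (s : PosWord α n × AuxData P.schema n)
    (δ : Option α × Fin n) : PosWord α n × AuxData P.schema n :=
  let w' : PosWord α n := Function.update s.1 δ.2 δ.1
  (w', fun R a =>
    letI := programStructure w' s.2
    (P.update δ.1 R).Realize (Sum.elim a fun _ => δ.2))

/-- The state reached from the initial state on `n` positions by a sequence of changes. -/
def run (P : Program α) (n : ℕ) (δs : List (Option α × Fin n)) :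
    PosWord α n × AuxData P.schema n :=
  δs.foldl P.step (initWord α n, P.initAux n)

/-- The value of the answer bit. -/
def answerBit (P : Program α) {n : ℕ} (A : AuxData P.schema n) : Prop :=
  A P.answer fun j => (Fin.cast P.answer_arity j).elim0

/-- The program maintains the dynamic membership problem of `L`: on every domain size and after
every sequence of changes, the answer bit tells whether the current word is in `L`. -/
def Maintains (P : Program α) (L : Language α) : Prop :=
  ∀ (n : ℕ) (δs : List (Option α × Fin n)),
    P.answerBit (P.run n δs).2 ↔ (P.run n δs).1.toList ∈ L

/-- All auxiliary relations are at most unary. -/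
def IsUnary (P : Program α) : Prop := ∀ R : P.schema.Sym, P.schema.arity R ≤ 1

/-- All update formulas are quantifier-free. -/
def IsQuantifierFree (P : Program α) : Prop :=
  ∀ (σ : Option α) (R : P.schema.Sym), (P.update σ R).IsQF

end Program

/-- The dynamic membership problem of `L` is in `UDynProp`: it is maintained by a dynamic program
with at most unary auxiliary relations, quantifier-free update formulas, and first-order
initialization. -/
def UDynProp {α : Type u} (L : Language α) : Prop :=
  ∃ P : Program α, P.IsUnary ∧ P.IsQuantifierFree ∧ P.Maintains L

/-! ### The syntactic monoid -/

/-- The action of words on the states of an automaton. The opposite monoid makes the product of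
the transformations of `u` and `v` the transformation of `uv`: first `u`, then `v`. -/
def transitionHom {α σ : Type*} (M : DFA α σ) : FreeMonoid α →* (Function.End σ)ᵐᵒᵖ :=
  FreeMonoid.lift fun a => MulOpposite.op fun s => M.step s a

/-- The transition monoid of an automaton. -/
def transitionMonoid {α σ : Type*} (M : DFA α σ) : Submonoid (Function.End σ)ᵐᵒᵖ :=
  MonoidHom.mrange (transitionHom M)

/-- The syntactic monoid of `L`: the transition monoid of its minimal automaton, that is, of the
automaton `L.toDFA` whose states are the left quotients of `L`. -/
def syntacticMonoid {α : Type*} (L : Language α) :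
    Submonoid (Function.End (Set.range L.leftQuotient))ᵐᵒᵖ :=
  transitionMonoid L.toDFA

end DynWord

/-! If the syntactic monoid is a group `G`, a program keeps, for every position, the product in `G` of
the letters before it and the product up to and including it, together with the product of the whole
word. A change at `y` replaces each product `c` of a prefix that contains `y` by `p s q⁻¹ c`, where
`p` and `q` are the old products before and through `y` and `s` is the value of the new letter. This
is a quantifier-free condition on `y` and one further position (`prefixProd_update_of_lt`,
`uDynProp_of_group`).

Conversely, let a program with unary relations and quantifier-free updates maintain `L`. Because
quantifier-free formulas are preserved by embeddings, a state that embeds into another one keeps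
doing so, with the same answers, when corresponding positions change (`Program.Agree.step`). With
unary relations a state is just a word over a finite alphabet of colours, so by Higman's lemma every
infinite sequence of states has one that embeds into a later one (`exists_lt_orderEmbedding`).
For a letter `a` choose `k ≥ 1` such that `aᵏ` is idempotent in the syntactic monoid. Among states
for `x aᵏ y`, `x a²ᵏ y`, … there is such an embedding; erasing the `a`s of the smaller word and their
images in the larger one yields `x y` on one side and `x aᵏᵖ y` with `p ≠ 0` on the other
(`UDynProp.append_mem_iff`). Hence `aᵏ` is syntactically equivalent to the empty word, every letter
is a unit, and so is every element of the syntactic monoid. -/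

namespace DynWord

universe u

open FirstOrder Language

/-! ### Prefix products in a group -/

section PrefixProducts

variable {α : Type u} {G : Type*} [Group G]

/-- The value of the content of a position: `φ a` for a letter `a`, and `1` for `ε`. -/
def letterVal (φ : α → G) (σ : Option α) : G := σ.elim 1 φ

/-- The product of the values of the first `j` positions of `w`. For a position `y : Fin n`,
`prefixProd φ w y` leaves `y` out and `prefixProd φ w (y + 1)` takes it in. -/
def prefixProd (φ : α → G) {n : ℕ} (w : PosWord α n) (j : ℕ) : G :=
  ((List.ofFn fun i => letterVal φ (w i)).take j).prod

variable (φ : α → G) {n : ℕ} (w : PosWord α n)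

theorem prefixProd_initWord (j : ℕ) : prefixProd φ (Program.initWord α n) j = 1 := by
  simp [prefixProd, Program.initWord, letterVal, List.ofFn_const, List.take_replicate]

theorem prefixProd_length : prefixProd φ w n = (w.toList.map φ).prod := by
  have key : ∀ l : List (Option α),
      (l.map (letterVal φ)).prod = (l.reduceOption.map φ).prod := by
    intro l
    induction l with
    | nil => simp
    | cons o l ih => cases o <;> simp [ih, letterVal, List.reduceOption_cons_of_some,
        List.reduceOption_cons_of_none]
  rw [PosWord.toList, ← key, List.map_ofFn, prefixProd, List.take_of_length_le (by simp)]
  rfl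

theorem ofFn_letterVal_update (y : Fin n) (σ : Option α) :
    (List.ofFn fun i => letterVal φ (Function.update w y σ i)) =
      (List.ofFn fun i => letterVal φ (w i)).set y (letterVal φ σ) := by
  apply List.ext_getElem
  · simp
  · intro i h₁ h₂
    rw [List.getElem_set]
    by_cases h : (y : ℕ) = i
    · subst h; simp
    · have : (⟨i, by simpa using h₁⟩ : Fin n) ≠ y := fun h' => h (by simp [← h'])
      simp [h, Function.update_of_ne this]

theorem prefixProd_update_of_le (y : Fin n) (σ : Option α) {j : ℕ} (hj : j ≤ y) :
    prefixProd φ (Function.update w y σ) j = prefixProd φ w j := by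
  rw [prefixProd, ofFn_letterVal_update, List.take_set_of_le hj, prefixProd]

/-- A change at `y` alters every longer prefix product by a factor that depends only on the old
prefix products at `y`. This is where inverses are needed. -/
theorem prefixProd_update_of_lt (y : Fin n) (σ : Option α) {j : ℕ} (hj : (y : ℕ) < j) :
    prefixProd φ (Function.update w y σ) j =
      prefixProd φ w y * letterVal φ σ * (prefixProd φ w (y + 1))⁻¹ * prefixProd φ w j := by
  have split : prefixProd φ w j = prefixProd φ w (y + 1) *
      (((List.ofFn fun i => letterVal φ (w i)).take j).drop (y + 1)).prod := by
    have := List.prod_take_mul_prod_drop ((List.ofFn fun i => letterVal φ (w i)).take j) (y + 1)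
    rw [List.take_take, min_eq_left (show (y : ℕ) + 1 ≤ j from hj)] at this
    exact this.symm
  rw [mul_assoc, split, inv_mul_cancel_left, prefixProd, ofFn_letterVal_update, List.take_set,
    List.prod_set, List.take_take, min_eq_left hj.le, if_pos (by simp [hj]), prefixProd]

end PrefixProducts

/-! ### Auxiliary relations for prefix products -/

section Schema

variable {G : Type}

variable (G) in
/-- The auxiliary symbols of the program for a group `G`: unary relations for the two prefix
products at a position, bits for the total product, and the answer bit. -/
inductive PrefixSym : Type
  /-- the product of the positions strictly before `x` is `g` -/
  | strict (g : G)
  /-- the product of the positions up to and including `x` is `g` -/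
  | incl (g : G)
  /-- the product of all positions is `g` -/
  | total (g : G)
  /-- the answer bit -/
  | answer

instance [Finite G] : Finite (PrefixSym G) :=
  Finite.of_surjective (fun x : (G ⊕ G) ⊕ Option G => match x with
    | .inl (.inl g) => PrefixSym.strict g
    | .inl (.inr g) => PrefixSym.incl g
    | .inr (some g) => PrefixSym.total g
    | .inr none => PrefixSym.answer) (by
    rintro (g | g | g | _)
    exacts [⟨.inl (.inl g), rfl⟩, ⟨.inl (.inr g), rfl⟩, ⟨.inr (some g), rfl⟩, ⟨.inr none, rfl⟩])

variable (G) in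
/-- The schema formed by `PrefixSym G`. -/
@[reducible]
def prefixSchema [Finite G] : AuxSchema where
  Sym := PrefixSym G
  finite_sym := inferInstance
  arity
    | .strict _ => 1
    | .incl _ => 1
    | .total _ => 0
    | .answer => 0

end Schema

theorem isQF_iSup {L : Language} {γ : Type*} {k : ℕ} {ι : Type*} [Finite ι]
    {f : ι → L.BoundedFormula γ k} (hf : ∀ i, (f i).IsQF) : (BoundedFormula.iSup f).IsQF := by
  rw [BoundedFormula.iSup]
  generalize (@Finset.univ ι (Fintype.ofFinite ι)).toList = l
  induction l with
  | nil => exact BoundedFormula.isQF_bot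
  | cons i l ih => exact (hf i).sup ih

section Atoms

variable (α : Type u) (G : Type) [Finite G] {β : Type}

/-- The atomic formula: `x` satisfies the relation `PrefixSym.strict g`. -/
def strictRel (g : G) (x : β) : (programLang α (prefixSchema G)).Formula β :=
  Relations.formula₁ (L := programLang α (prefixSchema G))
    (Sum.inr (AuxRel.sym (S := prefixSchema G) (.strict g))) (Term.var x)

/-- The atomic formula: `x` satisfies the relation `PrefixSym.incl g`. -/
def inclRel (g : G) (x : β) : (programLang α (prefixSchema G)).Formula β :=
  Relations.formula₁ (L := programLang α (prefixSchema G))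
    (Sum.inr (AuxRel.sym (S := prefixSchema G) (.incl g))) (Term.var x)

/-- The atomic formula: the bit `PrefixSym.total g` is set. -/
def totalRel (g : G) : (programLang α (prefixSchema G)).Formula β :=
  Relations.formula (L := programLang α (prefixSchema G)) (n := 0)
    (Sum.inr (AuxRel.sym (S := prefixSchema G) (.total g))) Fin.elim0

/-- The atomic formula: `x ≤ y`. -/
def leRel (x y : β) : (programLang α (prefixSchema G)).Formula β :=
  Relations.formula₂ (L := programLang α (prefixSchema G))
    (Sum.inl InputRel.le) (Term.var x) (Term.var y)

variable {α G}

theorem isQF_strictRel (g : G) (x : β) : (strictRel α G g x).IsQF :=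
  (BoundedFormula.IsAtomic.rel _ _).isQF

theorem isQF_inclRel (g : G) (x : β) : (inclRel α G g x).IsQF :=
  (BoundedFormula.IsAtomic.rel _ _).isQF

theorem isQF_totalRel (g : G) : (totalRel α G (β := β) g).IsQF :=
  (BoundedFormula.IsAtomic.rel _ _).isQF

theorem isQF_leRel (x y : β) : (leRel α G x y).IsQF :=
  (BoundedFormula.IsAtomic.rel _ _).isQF

end Atoms

/-! ### The program for a finite group -/

section Program

variable {α : Type u} {G : Type} [Group G] [Finite G] (φ : α → G) {n : ℕ} (w : PosWord α n)

/-- The intended auxiliary relations on the word `w`; the answer bit says that the total product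
lies in `S`. -/
def prefixAux (S : Set G) : AuxData (prefixSchema G) n
  | .strict g, v => prefixProd φ w (v 0 : Fin n) = g
  | .incl g, v => prefixProd φ w ((v 0 : Fin n) + 1) = g
  | .total g, _ => prefixProd φ w n = g
  | .answer, _ => prefixProd φ w n ∈ S

section Formulas

variable (α G) {β : Type}

open Classical in
/-- The update of a prefix product beyond the changed position `y`: if `s` is the value of the new
content of `y`, and `χ c` says that the old product was `c`, then the formula says that the new
product, as given by `prefixProd_update_of_lt`, lies in `T`. -/
noncomputable def newProd (s : G) (T : Set G) (χ : G → (programLang α (prefixSchema G)).Formula β)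
    (y : β) : (programLang α (prefixSchema G)).Formula β :=
  BoundedFormula.iSup fun t : G × G × G =>
    if t.1 * s * t.2.1⁻¹ * t.2.2 ∈ T then
      strictRel α G t.1 y ⊓ inclRel α G t.2.1 y ⊓ χ t.2.2
    else ⊥

variable {α G}

theorem isQF_newProd (s : G) (T : Set G) {χ : G → (programLang α (prefixSchema G)).Formula β}
    (hχ : ∀ g, (χ g).IsQF) (y : β) : (newProd α G s T χ y).IsQF := by
  refine isQF_iSup fun t => ?_
  split_ifs
  · exact ((isQF_strictRel _ _).inf (isQF_inclRel _ _)).inf (hχ _)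
  · exact BoundedFormula.isQF_bot

variable (S : Set G) (w' : PosWord α n) (v : β → Fin n)

theorem realize_strictRel (g : G) (x : β) :
    letI := programStructure w' (prefixAux φ w S)
    (strictRel α G g x).Realize v ↔ prefixProd φ w (v x) = g := by
  let := programStructure w' (prefixAux φ w S)
  exact Formula.realize_rel₁

theorem realize_inclRel (g : G) (x : β) :
    letI := programStructure w' (prefixAux φ w S)
    (inclRel α G g x).Realize v ↔ prefixProd φ w (v x + 1) = g := by
  let := programStructure w' (prefixAux φ w S)
  exact Formula.realize_rel₁

theorem realize_totalRel (g : G) :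
    letI := programStructure w' (prefixAux φ w S)
    (totalRel α G g).Realize v ↔ prefixProd φ w n = g := by
  let := programStructure w' (prefixAux φ w S)
  exact Formula.realize_rel

theorem realize_leRel (x y : β) :
    letI := programStructure w' (prefixAux φ w S)
    (leRel α G x y).Realize v ↔ v x ≤ v y := by
  let := programStructure w' (prefixAux φ w S)
  exact Formula.realize_rel₂

theorem realize_newProd (s : G) (T : Set G) {χ : G → (programLang α (prefixSchema G)).Formula β}
    (p : G) (y : β)
    (hχ : letI := programStructure w' (prefixAux φ w S); ∀ g, (χ g).Realize v ↔ p = g) :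
    letI := programStructure w' (prefixAux φ w S)
    (newProd α G s T χ y).Realize v ↔
      prefixProd φ w (v y) * s * (prefixProd φ w (v y + 1))⁻¹ * p ∈ T := by
  let := programStructure w' (prefixAux φ w S)
  refine BoundedFormula.realize_iSup.trans ⟨?_, fun h => ?_⟩
  · rintro ⟨t, ht⟩
    split_ifs at ht with hT
    · obtain ⟨⟨h₁, h₂⟩, h₃⟩ := by simpa only [BoundedFormula.realize_inf] using ht
      rw [(realize_strictRel φ w S w' v _ _).1 h₁, (realize_inclRel φ w S w' v _ _).1 h₂,
        (hχ _).1 h₃]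
      exact hT
    · exact absurd ht id
  · refine ⟨(prefixProd φ w (v y), prefixProd φ w (v y + 1), p), ?_⟩
    rw [if_pos h]
    simp only [BoundedFormula.realize_inf]
    exact ⟨⟨(realize_strictRel φ w S w' v _ _).2 rfl, (realize_inclRel φ w S w' v _ _).2 rfl⟩,
      (hχ _).2 rfl⟩

end Formulas

open Classical in
variable (α) in
/-- The initialization formulas; on the empty word every product is `1`. -/
noncomputable def prefixInit (S : Set G) :
    ∀ R : PrefixSym G, (inputLang α).Formula (Fin ((prefixSchema G).arity R))
  | .strict g => if g = 1 then ⊤ else ⊥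
  | .incl g => if g = 1 then ⊤ else ⊥
  | .total g => if g = 1 then ⊤ else ⊥
  | .answer => if 1 ∈ S then ⊤ else ⊥

/-- The update formulas; `Sum.inl 0` is the argument of a unary relation and `Sum.inr ()` the
changed position. -/
noncomputable def prefixUpdate (S : Set G) (σ : Option α) : ∀ R : PrefixSym G,
    (programLang α (prefixSchema G)).Formula (Fin ((prefixSchema G).arity R) ⊕ Unit)
  | .strict g =>
    (leRel α G (.inl 0) (.inr ()) ⊓ strictRel α G g (.inl 0)) ⊔
      ((leRel α G (.inl 0) (.inr ())).not ⊓
        newProd α G (letterVal φ σ) {g} (fun c => strictRel α G c (.inl 0)) (.inr ()))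
  | .incl g =>
    ((leRel α G (.inr ()) (.inl 0)).not ⊓ inclRel α G g (.inl 0)) ⊔
      (leRel α G (.inr ()) (.inl 0) ⊓
        newProd α G (letterVal φ σ) {g} (fun c => inclRel α G c (.inl 0)) (.inr ()))
  | .total g => newProd α G (letterVal φ σ) {g} (fun c => totalRel α G c) (.inr ())
  | .answer => newProd α G (letterVal φ σ) S (fun c => totalRel α G c) (.inr ())

/-- The program that maintains the prefix products in `G` and whether the total product lies in
`S`. -/
noncomputable def prefixProgram (S : Set G) : Program α where
  schema := prefixSchema G
  init := prefixInit α S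
  update := prefixUpdate φ S
  answer := .answer
  answer_arity := rfl

theorem prefixProgram_isUnary (S : Set G) : (prefixProgram φ S).IsUnary := by
  rintro (_ | _ | _ | _) <;> simp [prefixProgram]

theorem isQF_prefixUpdate (S : Set G) (σ : Option α) (R : PrefixSym G) :
    (prefixUpdate φ S σ R).IsQF := by
  rcases R with g | g | g | _
  · exact ((isQF_leRel _ _).inf (isQF_strictRel _ _)).sup
      ((isQF_leRel _ _).not.inf (isQF_newProd _ _ (fun _ => isQF_strictRel _ _) _))
  · exact ((isQF_leRel _ _).not.inf (isQF_inclRel _ _)).sup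
      ((isQF_leRel _ _).inf (isQF_newProd _ _ (fun _ => isQF_inclRel _ _) _))
  · exact isQF_newProd (letterVal φ σ) {g} (χ := fun c => totalRel α G c) isQF_totalRel _
  · exact isQF_newProd (letterVal φ σ) S (χ := fun c => totalRel α G c) isQF_totalRel _

theorem realize_prefixInit (S : Set G) (R : PrefixSym G)
    (a : Fin ((prefixSchema G).arity R) → Fin n) :
    letI := inputStructure (Program.initWord α n)
    (prefixInit α S R).Realize a ↔ prefixAux φ (Program.initWord α n) S R a := by
  classical
  let := inputStructure (Program.initWord α n)
  have key : ∀ {k : ℕ} (p : Prop) [Decidable p] (a : Fin k → Fin n),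
      (if p then (⊤ : (inputLang α).Formula (Fin k)) else ⊥).Realize a ↔ p := by
    intro k p _ a
    split_ifs with h
    · simp [h]
    · simp only [h, iff_false]; exact id
  rcases R with g | g | g | _
  · refine (key (g = 1) a).trans ?_
    simp [prefixAux, prefixProd_initWord, eq_comm]
  · refine (key (g = 1) a).trans ?_
    simp [prefixAux, prefixProd_initWord, eq_comm]
  · refine (key (g = 1) a).trans ?_
    simp [prefixAux, prefixProd_initWord, eq_comm]
  · refine (key (1 ∈ S) a).trans ?_
    simp [prefixAux, prefixProd_initWord]

theorem realize_prefixUpdate (S : Set G) (σ : Option α) (y : Fin n) (R : PrefixSym G)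
    (a : Fin ((prefixSchema G).arity R) → Fin n) :
    letI := programStructure (Function.update w y σ) (prefixAux φ w S)
    (prefixUpdate φ S σ R).Realize (Sum.elim a fun _ => y) ↔
      prefixAux φ (Function.update w y σ) S R a := by
  let := programStructure (Function.update w y σ) (prefixAux φ w S)
  rcases R with g | g | g | _
  · let v : Fin 1 ⊕ Unit → Fin n := Sum.elim a fun _ => y
    refine (Formula.realize_sup.trans (or_congr
      (Formula.realize_inf.trans
        (and_congr (realize_leRel φ w S _ v _ _) (realize_strictRel φ w S _ v _ _)))
      (Formula.realize_inf.trans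
        (and_congr (Formula.realize_not.trans (not_congr (realize_leRel φ w S _ v _ _)))
          (realize_newProd φ w S _ v _ _ (prefixProd φ w (a (0 : Fin 1))) _
            fun c => realize_strictRel φ w S _ v c _))))).trans ?_
    change (a (0 : Fin 1) ≤ y ∧ prefixProd φ w (a (0 : Fin 1)) = g ∨
      ¬ a (0 : Fin 1) ≤ y ∧ prefixProd φ w y * letterVal φ σ * (prefixProd φ w (y + 1))⁻¹ *
        prefixProd φ w (a (0 : Fin 1)) = g) ↔
      prefixProd φ (Function.update w y σ) (a (0 : Fin 1)) = g
    rcases le_or_gt (a (0 : Fin 1)) y with h | h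
    · simp [h, prefixProd_update_of_le φ w y σ (Fin.le_def.1 h)]
    · simp [h.not_ge, prefixProd_update_of_lt φ w y σ (Fin.lt_def.1 h)]
  · let v : Fin 1 ⊕ Unit → Fin n := Sum.elim a fun _ => y
    refine (Formula.realize_sup.trans (or_congr
      (Formula.realize_inf.trans
        (and_congr (Formula.realize_not.trans (not_congr (realize_leRel φ w S _ v _ _)))
          (realize_inclRel φ w S _ v _ _)))
      (Formula.realize_inf.trans
        (and_congr (realize_leRel φ w S _ v _ _)
          (realize_newProd φ w S _ v _ _ (prefixProd φ w (a (0 : Fin 1) + 1)) _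
            fun c => realize_inclRel φ w S _ v c _))))).trans ?_
    change (¬ y ≤ a (0 : Fin 1) ∧ prefixProd φ w (a (0 : Fin 1) + 1) = g ∨
      y ≤ a (0 : Fin 1) ∧ prefixProd φ w y * letterVal φ σ * (prefixProd φ w (y + 1))⁻¹ *
        prefixProd φ w (a (0 : Fin 1) + 1) = g) ↔
      prefixProd φ (Function.update w y σ) (a (0 : Fin 1) + 1) = g
    rcases le_or_gt y (a (0 : Fin 1)) with h | h
    · simp [h, prefixProd_update_of_lt φ w y σ (Nat.lt_succ_of_le (Fin.le_def.1 h))]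
    · simp [h.not_ge, prefixProd_update_of_le φ w y σ (Nat.succ_le_of_lt (Fin.lt_def.1 h))]
  · refine (realize_newProd φ w S _ _ _ _ (prefixProd φ w n) _
      fun c => realize_totalRel φ w S _ _ c).trans ?_
    rw [prefixAux, prefixProd_update_of_lt φ w y σ y.isLt]
    exact Iff.rfl
  · refine (realize_newProd φ w S _ _ _ _ (prefixProd φ w n) _
      fun c => realize_totalRel φ w S _ _ c).trans ?_
    rw [prefixAux, prefixProd_update_of_lt φ w y σ y.isLt]
    exact Iff.rfl

/-- The auxiliary relations are always the intended ones for the current word. -/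
theorem prefixProgram_run (S : Set G) (n : ℕ) (δs : List (Option α × Fin n)) :
    ∃ w, (prefixProgram φ S).run n δs = (w, prefixAux φ w S) := by
  have h₀ : (prefixProgram φ S).initAux n = prefixAux φ (Program.initWord α n) S :=
    funext fun R => funext fun a => propext (realize_prefixInit φ S R a)
  rw [Program.run, h₀]
  generalize Program.initWord α n = w
  induction δs generalizing w with
  | nil => exact ⟨w, rfl⟩
  | cons δ δs ih =>
    have h : (prefixProgram φ S).step (w, prefixAux φ w S) δ =
        (Function.update w δ.2 δ.1, prefixAux φ (Function.update w δ.2 δ.1) S) :=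
      Prod.ext rfl (funext fun R => funext fun a =>
        propext (realize_prefixUpdate φ w S δ.1 δ.2 R a))
    rw [List.foldl_cons, h]
    exact ih _

/-- A language recognized by a finite group is in `UDynProp`. -/
theorem uDynProp_of_group (S : Set G) (L : Language α)
    (hL : ∀ u, u ∈ L ↔ (u.map φ).prod ∈ S) : UDynProp L := by
  refine ⟨prefixProgram φ S, prefixProgram_isUnary φ S, isQF_prefixUpdate φ S, ?_⟩
  intro n δs
  obtain ⟨w, hw⟩ := prefixProgram_run φ S n δs
  rw [hw, hL, ← prefixProd_length]
  exact Iff.rfl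

end Program

/-! ### Words over positions and Higman's lemma -/

section Words

variable {α : Type u}

/-- The positional word with the letters of `x`, then `v`, then the letters of `y`. -/
def paddedWord (x y : List α) {N : ℕ} (v : PosWord α N) : PosWord α (x.length + N + y.length) :=
  Fin.append (Fin.append (fun i => some (x.get i)) v) (fun i => some (y.get i))

/-- A colouring of the positions of a padded word: each position of the two outer parts has a
colour of its own, and all inner positions share the colour `none`. -/
def zone (p N q : ℕ) : Fin (p + N + q) → Option (Fin p ⊕ Fin q) :=
  Fin.append (Fin.append (fun i => some (.inl i)) fun _ => none) (fun i => some (.inr i))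

theorem toList_paddedWord (x y : List α) {N : ℕ} (v : PosWord α N) :
    (paddedWord x y v).toList = x ++ v.toList ++ y := by
  have h : ∀ l : List α, (List.ofFn fun i => some (l.get i)).reduceOption = l := by
    intro l
    have : (List.ofFn fun i => some (l.get i)) = l.map some := by
      conv_rhs => rw [← List.ofFn_get l, List.map_ofFn]
      rfl
    rw [this, List.reduceOption, List.filterMap_map]
    exact List.filterMap_some
  rw [PosWord.toList, paddedWord, List.ofFn_fin_append, List.ofFn_fin_append,
    List.reduceOption_append, List.reduceOption_append, h, h, PosWord.toList]

theorem length_toList_add {n : ℕ} (w : PosWord α n) :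
    w.toList.length + Fintype.card {i // w i = none} = n := by
  classical
  induction n with
  | zero => simp [PosWord.toList]
  | succ n ih =>
    have h := ih fun i => w i.succ
    rw [Fintype.card_subtype] at h ⊢
    rw [Fin.card_filter_univ_succ]
    rw [PosWord.toList] at h ⊢
    rw [List.ofFn_succ]
    cases h0 : w 0 with
    | none =>
      rw [List.reduceOption_cons_of_none]
      simp at h ⊢
      omega
    | some a =>
      rw [List.reduceOption_cons_of_some]
      simp at h ⊢
      omega

theorem card_ite_eq_none {n : ℕ} {u : PosWord α n} {q : List (Fin n)} (hq : q.Nodup)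
    (hu : ∀ i, u i ≠ none) :
    Fintype.card {i // (if i ∈ q then none else u i) = none} = q.length := by
  rw [Fintype.card_subtype, ← List.toFinset_card_of_nodup hq]
  congr 1
  ext i
  simp [hu]

theorem toList_eq_replicate {n : ℕ} (w : PosWord α n) (a : α)
    (h : ∀ i, w i = none ∨ w i = some a) :
    w.toList = List.replicate w.toList.length a := by
  refine List.eq_replicate_iff.2 ⟨rfl, fun b hb => ?_⟩
  obtain ⟨i, hi⟩ := List.mem_ofFn.1 (List.reduceOption_mem_iff.1 hb)
  rcases h i with h | h <;> simp_all

theorem exists_orderEmbedding_of_ofFn_sublist {γ : Type*} {n m : ℕ} {f : Fin n → γ} {g : Fin m → γ}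
    (h : (List.ofFn f).Sublist (List.ofFn g)) : ∃ e : Fin n ↪o Fin m, ∀ i, f i = g (e i) := by
  obtain ⟨e, he⟩ := List.sublist_iff_exists_fin_orderEmbedding_get_eq.1 h
  refine ⟨(Fin.castOrderIso (List.length_ofFn (f := f)).symm).toOrderEmbedding.trans
    (e.trans (Fin.castOrderIso (List.length_ofFn (f := g))).toOrderEmbedding), fun i => ?_⟩
  have := he (Fin.cast (List.length_ofFn (f := f)).symm i)
  simp only [List.get_ofFn] at this
  simpa using this

/-- Higman's lemma over a finite alphabet: in every infinite sequence of words, some word embeds into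
a later one. -/
theorem exists_lt_orderEmbedding {γ : Type*} [Finite γ] (n : ℕ → ℕ) (f : ∀ j, Fin (n j) → γ) :
    ∃ j k, j < k ∧ ∃ e : Fin (n j) ↪o Fin (n k), ∀ i, f j i = f k (e i) := by
  have hpwo : (Set.univ : Set γ).PartiallyWellOrderedOn (· = ·) :=
    Set.Finite.partiallyWellOrderedOn Set.finite_univ
  obtain ⟨j, k, hjk, h⟩ := (Set.PartiallyWellOrderedOn.partiallyWellOrderedOn_sublistForall₂
    (· = ·) hpwo) (fun j => ⟨List.ofFn (f j), fun _ _ => trivial⟩)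
  obtain ⟨l, hl, hsub⟩ := List.sublistForall₂_iff.1 h
  rw [List.forall₂_eq_eq_eq] at hl
  subst hl
  exact ⟨j, k, hjk, exists_orderEmbedding_of_ofFn_sublist hsub⟩

end Words

/-! ### Simulation along order embeddings -/

namespace Program

variable {α : Type u} (P : Program α)

/-- The word after writing `g i` at each position `i` in a list. -/
theorem foldl_step_fst {n : ℕ} (g : Fin n → Option α) (l : List (Fin n))
    (s : PosWord α n × AuxData P.schema n) :
    ((l.map fun i => (g i, i)).foldl P.step s).1 = fun i => if i ∈ l then g i else s.1 i := by
  induction l generalizing s with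
  | nil => simp
  | cons j l ih =>
    rw [List.map_cons, List.foldl_cons, ih]
    funext i
    by_cases hi : i ∈ l
    · simp [hi]
    · by_cases hij : i = j
      · subst hij; simp [hi, step]
      · simp [hi, hij, step]

theorem exists_run_fst_eq {n : ℕ} (w : PosWord α n) : ∃ δs, (P.run n δs).1 = w :=
  ⟨(List.finRange n).map fun i => (w i, i), by rw [run, foldl_step_fst]; simp⟩

/-- The state `s` on `Fin n` is the substructure of the state `t` on `Fin m` along `e`, in the letters
and in the auxiliary relations. -/
def Agree {n m : ℕ} (e : Fin n ↪o Fin m) (s : PosWord α n × AuxData P.schema n)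
    (t : PosWord α m × AuxData P.schema m) : Prop :=
  (∀ i, s.1 i = t.1 (e i)) ∧ ∀ R a, s.2 R a ↔ t.2 R (e ∘ a)

variable {P}

/-- The embedding of program structures given by an order embedding that respects the letters and
the auxiliary relations. -/
def structureEmbedding {S : AuxSchema} {n m : ℕ} (e : Fin n ↪o Fin m) {w : PosWord α n}
    {w' : PosWord α m} {A : AuxData S n} {A' : AuxData S m} (hw : ∀ i, w i = w' (e i))
    (hA : ∀ R a, A R a ↔ A' R (e ∘ a)) :
    @FirstOrder.Language.Embedding (programLang α S) (Fin n) (Fin m)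
      (programStructure w A) (programStructure w' A') :=
  letI := programStructure w A
  letI := programStructure w' A'
  { toEmbedding := e.toEmbedding
    map_fun' := fun {_} f _ => by rcases f with f | f <;> exact f.elim
    map_rel' := fun {_} r v => by
      rcases r with (_ | _) | r
      · change w' (e (v 0)) = some _ ↔ w (v 0) = some _
        rw [hw]
      · change e (v 0) ≤ e (v 1) ↔ v 0 ≤ v 1
        exact e.le_iff_le
      · cases r with
        | sym R => exact (hA R v).symm }

/-- Agreement persists when both states undergo the same change at corresponding positions:
quantifier-free formulas are preserved by embeddings. -/
theorem Agree.step (hP : P.IsQuantifierFree) {n m : ℕ} {e : Fin n ↪o Fin m}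
    {s : PosWord α n × AuxData P.schema n} {t : PosWord α m × AuxData P.schema m}
    (h : P.Agree e s t) (σ : Option α) (i : Fin n) :
    P.Agree e (P.step s (σ, i)) (P.step t (σ, e i)) := by
  have hw : ∀ j, Function.update s.1 i σ j = Function.update t.1 (e i) σ (e j) := by
    intro j
    by_cases hj : j = i
    · subst hj; simp
    · rw [Function.update_of_ne hj, Function.update_of_ne (e.injective.ne hj), h.1]
  refine ⟨hw, fun R a => ?_⟩
  let := programStructure (Function.update s.1 i σ) s.2
  let := programStructure (Function.update t.1 (e i) σ) t.2
  have := BoundedFormula.IsQF.realize_embedding (hP σ R) (structureEmbedding e hw h.2)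
    (v := Sum.elim a fun _ => i) (xs := default)
  refine Iff.symm (Iff.trans (Iff.of_eq ?_) this)
  change BoundedFormula.Realize _ _ _ = _
  congr 1
  · funext z; rcases z with z | z <;> rfl
  · exact Subsingleton.elim _ _

theorem Agree.foldl (hP : P.IsQuantifierFree) {n m : ℕ} {e : Fin n ↪o Fin m}
    {s : PosWord α n × AuxData P.schema n} {t : PosWord α m × AuxData P.schema m}
    (h : P.Agree e s t) (δs : List (Option α × Fin n)) :
    P.Agree e (δs.foldl P.step s) ((δs.map (Prod.map id e)).foldl P.step t) := by
  induction δs generalizing s t with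
  | nil => exact h
  | cons δ δs ih => exact ih (h.step hP δ.1 δ.2)

theorem Agree.answerBit_iff {n m : ℕ} {e : Fin n ↪o Fin m}
    {s : PosWord α n × AuxData P.schema n} {t : PosWord α m × AuxData P.schema m}
    (h : P.Agree e s t) : P.answerBit s.2 ↔ P.answerBit t.2 := by
  refine (h.2 _ _).trans (Iff.of_eq (congrArg _ ?_))
  funext j
  exact (Fin.cast P.answer_arity j).elim0

end Program

/-! ### The lower bound -/

/-- For a language in `UDynProp`, a block `aᵏ` all of whose positive powers look alike between `x` and
`y` also looks like the empty word there. The words `x aᵏ⁽ʲ⁺¹⁾ y` are written by the program; by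
Higman's lemma one of the resulting states embeds into a later one, and erasing the inner block of
the former together with its image in the latter leaves `x y` and `x aᵏᵖ y` with `p ≠ 0`, on which
the program gives the same answer. -/
theorem UDynProp.append_mem_iff {α : Type u} [Finite α] {L : Language α} (hL : UDynProp L)
    (x y : List α) (a : α) {k : ℕ} (hk : k ≠ 0) {b : Prop}
    (hb : ∀ p ≠ 0, (x ++ List.replicate (k * p) a ++ y ∈ L ↔ b)) :
    x ++ y ∈ L ↔ b := by
  obtain ⟨P, hun, hqf, hmain⟩ := hL
  have := P.schema.finite_sym
  let N : ℕ → ℕ := fun j => k * (j + 1)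
  let wd : ∀ j, PosWord α (x.length + N j + y.length) := fun j => paddedWord x y fun _ => some a
  choose δs hδs using fun j => P.exists_run_fst_eq (wd j)
  obtain ⟨j, l, hjl, e, he⟩ := exists_lt_orderEmbedding (fun j => x.length + N j + y.length)
    fun j i => ((wd j i, zone x.length (N j) y.length i), fun R => (P.run _ (δs j)).2 R fun _ => i)
  simp only [Prod.mk.injEq] at he
  -- Since all arities are at most one and the domain is nonempty, an auxiliary relation is determined
  -- by its values on constant tuples, which are part of the colours.
  have hag : P.Agree e (P.run _ (δs j)) (P.run _ (δs l)) := by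
    refine ⟨fun i => by rw [hδs, hδs]; exact (he i).1.1, fun R v => ?_⟩
    obtain ⟨i, rfl⟩ : ∃ i, v = fun _ => i := by
      rcases Nat.le_one_iff_eq_zero_or_eq_one.1 (hun R) with h0 | h1
      · refine ⟨⟨0, ?_⟩, funext fun z => (Fin.cast h0 z).elim0⟩
        have : 0 < N j := by positivity
        omega
      · exact ⟨v (Fin.cast h1.symm 0), funext fun z => congrArg v (Fin.ext (by omega))⟩
    exact Iff.of_eq (congrFun (he i).2 R)
  -- The inner positions of the smaller word, which are now erased in both states.
  let mid := (List.finRange (x.length + N j + y.length)).filter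
    fun i => zone x.length (N j) y.length i = none
  have hfin := hag.foldl hqf (mid.map fun i => (none, i))
  have h₁ := hmain _ (δs j ++ mid.map fun i => (none, i))
  have h₂ := hmain _ (δs l ++ (mid.map fun i => (none, i)).map (Prod.map id e))
  have hmap : (mid.map fun i => ((none : Option α), i)).map (Prod.map id e) =
      (mid.map e).map fun i => (none, i) := by simp [Function.comp_def]
  simp only [Program.run, List.foldl_append] at h₁ h₂
  change P.answerBit (List.foldl P.step (P.run _ (δs j)) _).2 ↔
    (List.foldl P.step (P.run _ (δs j)) _).1.toList ∈ L at h₁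
  change P.answerBit (List.foldl P.step (P.run _ (δs l)) _).2 ↔
    (List.foldl P.step (P.run _ (δs l)) _).1.toList ∈ L at h₂
  rw [← hfin.answerBit_iff, h₁, hmap, Program.foldl_step_fst _ (fun _ => none),
    Program.foldl_step_fst _ (fun _ => none), hδs, hδs] at h₂
  have zone_mid : ∀ j (i : Fin (N j)), zone x.length (N j) y.length
      (Fin.castAdd _ (Fin.natAdd _ i)) = none := by
    intro j i; simp [zone]
  have zone_left : ∀ j (i : Fin x.length), zone x.length (N j) y.length
      (Fin.castAdd _ (Fin.castAdd _ i)) ≠ none := by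
    intro j i; simp [zone]
  have zone_right : ∀ j (i : Fin y.length), zone x.length (N j) y.length
      (Fin.natAdd _ i) ≠ none := by
    intro j i; simp [zone]
  have hmem : ∀ i, i ∈ mid ↔ zone x.length (N j) y.length i = none := by simp [mid]
  have hmem' : ∀ i ∈ mid.map e, zone x.length (N l) y.length i = none := by
    intro i hi
    obtain ⟨i', hi', rfl⟩ := List.mem_map.1 hi
    rw [← (he i').1.2]
    exact (hmem i').1 hi'
  have hw₁ : (fun i => if i ∈ mid then none else wd j i) =
      paddedWord x y (fun _ : Fin (N j) => none) := by
    funext i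
    induction i using Fin.addCases with
    | left i =>
      induction i using Fin.addCases with
      | left i =>
        rw [if_neg fun h => zone_left _ _ ((hmem _).1 h)]
        simp [wd, paddedWord]
      | right i =>
        rw [if_pos ((hmem _).2 (zone_mid _ _))]
        simp [paddedWord]
    | right i =>
      rw [if_neg fun h => zone_right _ _ ((hmem _).1 h)]
      simp [wd, paddedWord]
  let v : PosWord α (N l) := fun i =>
    if Fin.castAdd _ (Fin.natAdd _ i) ∈ mid.map e then none else some a
  have hw₂ : (fun i => if i ∈ mid.map e then none else wd l i) = paddedWord x y v := by
    funext i
    induction i using Fin.addCases with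
    | left i =>
      induction i using Fin.addCases with
      | left i =>
        rw [if_neg fun h => zone_left _ _ (hmem' _ h)]
        simp [wd, paddedWord]
      | right i => simp [wd, paddedWord, v]
    | right i =>
      rw [if_neg fun h => zone_right _ _ (hmem' _ h)]
      simp [wd, paddedWord]
  have wd_ne : ∀ j i, wd j i ≠ none := by
    intro j i
    induction i using Fin.addCases with
    | left i => induction i using Fin.addCases <;> simp [wd, paddedWord]
    | right i => simp [wd, paddedWord]
  have nodup : mid.Nodup := (List.nodup_finRange _).filter _
  -- As many positions are erased in the larger word as the inner block of the smaller one has.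
  have c₁ := length_toList_add fun i => if i ∈ mid then none else wd j i
  have c₂ := length_toList_add fun i => if i ∈ mid.map e then none else wd l i
  rw [card_ite_eq_none nodup (wd_ne j), hw₁, toList_paddedWord] at c₁
  rw [card_ite_eq_none (nodup.map e.injective) (wd_ne l), hw₂, toList_paddedWord] at c₂
  rw [hw₁, hw₂, toList_paddedWord, toList_paddedWord] at h₂
  have hnil : PosWord.toList (fun _ : Fin (N j) => (none : Option α)) = [] := by
    simp [PosWord.toList, List.ofFn_const]
  rw [toList_eq_replicate v a fun i => by simp only [v]; split_ifs <;> simp] at h₂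
  have hlen : v.toList.length = k * (l - j) := by
    have : N l = N j + k * (l - j) := by
      simp only [N]; rw [← mul_add]; congr 1; omega
    simp [hnil] at c₁ c₂
    omega
  rw [hlen, hb _ (by omega), hnil, List.append_nil] at h₂
  exact h₂

/-! ### Syntactic monoids -/

/-- Every element of a finite monoid has an idempotent power with positive exponent. -/
theorem exists_pow_mul_eq_pow {M : Type*} [Monoid M] [Finite M] (f : M) :
    ∃ k ≠ 0, ∀ p ≠ 0, f ^ (k * p) = f ^ k := by
  obtain ⟨i, j, hij, h⟩ : ∃ i j : ℕ, i < j ∧ f ^ i = f ^ j := by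
    obtain ⟨i, j, hne, h⟩ := Finite.exists_ne_map_eq_of_infinite fun n : ℕ => f ^ n
    rcases hne.lt_or_gt with hlt | hlt
    exacts [⟨i, j, hlt, h⟩, ⟨j, i, hlt, h.symm⟩]
  obtain ⟨d, rfl⟩ := Nat.exists_eq_add_of_lt hij
  have periodic : ∀ c : ℕ, f ^ (i + c * (d + 1)) = f ^ i := by
    intro c
    induction c with
    | zero => simp
    | succ c ih =>
      rw [show i + (c + 1) * (d + 1) = i + d + 1 + c * (d + 1) by ring, pow_add, ← h, ← pow_add, ih]
  -- The exponent is a multiple of the period `d + 1` which is at least the preperiod `i`.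
  refine ⟨(i + 1) * (d + 1), by positivity, fun p hp => ?_⟩
  obtain ⟨q, rfl⟩ := Nat.exists_eq_succ_of_ne_zero hp
  have hk : (i + 1) * (d + 1) = i + (i * d + d + 1) := by ring
  have hkq : (i + 1) * (d + 1) * q.succ =
      i + (i + 1) * q * (d + 1) + (i * d + d + 1) := by
    rw [Nat.succ_eq_add_one]; ring
  rw [hkq, pow_add, periodic, ← pow_add, ← hk]

section Transition

variable {α : Type*} {L : Language α}

theorem finite_end_leftQuotient (hL : L.IsRegular) :
    Finite (Function.End (Set.range L.leftQuotient))ᵐᵒᵖ := by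
  have := hL.finite_range_leftQuotient.to_subtype
  have : Finite (Function.End (Set.range L.leftQuotient)) :=
    inferInstanceAs (Finite (Set.range L.leftQuotient → Set.range L.leftQuotient))
  exact Finite.of_equiv _ MulOpposite.opEquiv

theorem transitionHom_apply {σ : Type*} (M : DFA α σ) (u : List α) (s : σ) :
    (transitionHom M (FreeMonoid.ofList u)).unop s = M.evalFrom s u := by
  induction u generalizing s with
  | nil => rfl
  | cons a u ih =>
    rw [FreeMonoid.ofList_cons, map_mul, DFA.evalFrom_cons, ← ih]
    rfl

theorem mem_iff_transitionHom_mem (u : List α) :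
    u ∈ L ↔ (transitionHom L.toDFA (FreeMonoid.ofList u)).unop L.toDFA.start ∈ L.toDFA.accept := by
  rw [transitionHom_apply]
  conv_lhs => rw [← L.accepts_toDFA]
  rfl

/-- Syntactically equivalent words act equally on the minimal automaton. -/
theorem transitionHom_eq_of_mem_iff {u v : List α}
    (h : ∀ x y : List α, x ++ u ++ y ∈ L ↔ x ++ v ++ y ∈ L) :
    transitionHom L.toDFA (FreeMonoid.ofList u) = transitionHom L.toDFA (FreeMonoid.ofList v) := by
  have evalFrom_val : ∀ (u : List α) (s : Set.range L.leftQuotient),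
      (L.toDFA.evalFrom s u).val = s.val.leftQuotient u := by
    intro u
    induction u with
    | nil => intro s; simp
    | cons a u ih =>
      intro s
      rw [DFA.evalFrom_cons, ih, Language.step_toDFA, ← Language.leftQuotient_append]
      rfl
  refine MulOpposite.unop_injective (funext fun s => Subtype.ext ?_)
  obtain ⟨_, x, rfl⟩ := s
  rw [transitionHom_apply, transitionHom_apply, evalFrom_val, evalFrom_val]
  ext y
  simpa [Language.mem_leftQuotient] using h x y

theorem isUnit_of_forall_letter_pow_eq_one
    (h : ∀ a : α, ∃ k ≠ 0, transitionHom L.toDFA (FreeMonoid.of a) ^ k = 1)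
    (x : syntacticMonoid L) : IsUnit x := by
  obtain ⟨u, rfl⟩ := (transitionHom L.toDFA).mrangeRestrict_surjective x
  induction u using FreeMonoid.inductionOn' with
  | one => rw [map_one]; exact isUnit_one
  | of_mul a u ih =>
    rw [map_mul]
    refine IsUnit.mul ?_ ih
    obtain ⟨k, hk, hpow⟩ := h a
    exact IsUnit.of_pow_eq_one (Subtype.ext hpow) hk

end Transition

theorem isUnit_of_uDynProp {α : Type*} [Finite α] {L : Language α} (hL : L.IsRegular)
    (h : UDynProp L) (x : syntacticMonoid L) : IsUnit x := by
  have := finite_end_leftQuotient hL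
  refine isUnit_of_forall_letter_pow_eq_one (fun a => ?_) x
  obtain ⟨k, hk, hidem⟩ := exists_pow_mul_eq_pow (transitionHom L.toDFA (FreeMonoid.of a))
  have hrep : ∀ m, transitionHom L.toDFA (FreeMonoid.ofList (List.replicate m a)) =
      transitionHom L.toDFA (FreeMonoid.of a) ^ m := by
    intro m
    rw [← map_pow]
    congr 1
    induction m with
    | zero => rfl
    | succ m ih => rw [List.replicate_succ, FreeMonoid.ofList_cons, ih, pow_succ']
  refine ⟨k, hk, ?_⟩
  rw [← hrep, ← map_one (transitionHom L.toDFA)]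
  refine (transitionHom_eq_of_mem_iff (u := []) fun x y => ?_).symm
  rw [List.append_nil]
  refine h.append_mem_iff x y a hk fun p hp => ?_
  rw [mem_iff_transitionHom_mem, mem_iff_transitionHom_mem]
  simp only [FreeMonoid.ofList_append, map_mul, hrep, hidem p hp]

theorem uDynProp_of_isUnit {α : Type*} {L : Language α} (hL : L.IsRegular)
    (h : ∀ x : syntacticMonoid L, IsUnit x) : UDynProp L := by
  have := finite_end_leftQuotient hL
  have : Finite (syntacticMonoid L) := Subtype.finite
  let : Group (syntacticMonoid L) := groupOfIsUnit h
  -- The symbols of a schema live in `Type`, so the group is moved there from the universe of `α`.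
  let ψ : FreeMonoid α →* Shrink.{0} (syntacticMonoid L) :=
    (Shrink.mulEquiv.{0} (α := syntacticMonoid L)).symm.toMonoidHom.comp
      (transitionHom L.toDFA).mrangeRestrict
  refine uDynProp_of_group (fun a => ψ (FreeMonoid.of a))
    {g | ((equivShrink.{0} (syntacticMonoid L)).symm g).val.unop L.toDFA.start ∈ L.toDFA.accept} L
    fun u => ?_
  have hprod : (u.map fun a => ψ (FreeMonoid.of a)).prod = ψ (FreeMonoid.ofList u) := by
    induction u with
    | nil => simp
    | cons a u ih => rw [List.map_cons, List.prod_cons, ih, FreeMonoid.ofList_cons, map_mul]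
  have hval : ((equivShrink.{0} (syntacticMonoid L)).symm (ψ (FreeMonoid.ofList u))).val =
      transitionHom L.toDFA (FreeMonoid.ofList u) :=
    congrArg Subtype.val ((equivShrink.{0} (syntacticMonoid L)).symm_apply_apply _)
  rw [mem_iff_transitionHom_mem, hprod, Set.mem_ofPred_eq, hval]

end DynWord

/-- The dynamic membership problem of a regular language over a finite alphabet is in `UDynProp`
if and only if the syntactic monoid of the language is a group. -/
theorem theorem2 {α : Type*} [Finite α] (L : Language α) (hL : L.IsRegular) :
    DynWord.UDynProp L ↔ ∀ x : DynWord.syntacticMonoid L, IsUnit x :=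
  ⟨DynWord.isUnit_of_uDynProp hL, DynWord.uDynProp_of_isUnit hL⟩
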